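/- Let $E=\{z\in\mathbb C:|z|<1\}$. A set $\Omega\subset\mathbb C$ is convex in the direction $e^{i\gamma}$ ($\gamma\in\mathbb R$) if every line parallel to the line through $0$ and $e^{i\gamma}$ has empty or connected intersection with $\Omega$. Let $K_\gamma$ be the class of univalent analytic functions $f$ in $E$ with $f(0)=0$, $f'(0)=1$ for which $f(E)$ is convex in the direction $e^{i\gamma}$. Let $K_{H(\gamma)}$ be the class of univalent sense-preserving harmonic maps $f=h+\overline g$ of $E$, with $h,g$ analytic in $E$, $h(0)=g(0)=0$, $h'(0)=1$ (sense-preserving meaning that $h'\neq0$ and $|g'/h'|<1$ in $E$), for which $f(E)$ is convex in the direction $e^{i\gamma}$. Both classes depend only on $\gamma$ modulo $\pi$. For $\varphi(z)=\sum_{n\ge0}a_nz^n$ and $\psi(z)=\sum_{n\ge0}A_nz^n$ analytic in $E$ put $(\varphi*\psi)(z)=\sum_{n\ge0}a_nA_nz^n$, and for $f=h+\overline g$ harmonic in $E$ put $f\,\widetilde*\,\varphi=h*\varphi+\overline{g*\varphi}$. Let $DCP$ be the class of functions $\varphi$ analytic in $E$ such that $\varphi*f\in K_\gamma$ for every $\gamma\in[0,\pi)$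 and every $f\in K_\gamma$. **Corollary 3.5.** Let $-\pi/2\le\alpha\le\pi/2$, and let $f=h+\overline g$, where $h,g$ are analytic in $E$ with $h(0)=g(0)=0$ and $h'(0)=1$, satisfy $$h(z)+e^{-2i\alpha}g(z)=\frac{z}{1-e^{i\alpha}z}\qquad(z\in E),$$ and $h'\ne0$, $|g'/h'|<1$ in $E$. Then $f\,\widetilde*\,\varphi\in K_{H(\pi/2-\alpha)}$ for every $\varphi\in DCP$. -/

import Mathlib

open scoped ComplexConjugate

namespace HarmonicConvolution

/-- The open unit disk `E = {z : |z| < 1}`. -/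
abbrev unitDisk : Set ℂ := Metric.ball (0 : ℂ) 1

/-- The `n`-th Taylor coefficient of `φ` at the origin. -/
noncomputable def taylorCoeff (φ : ℂ → ℂ) (n : ℕ) : ℂ :=
  iteratedDeriv n φ 0 / (n.factorial : ℂ)

/-- The convolution (Hadamard product) `(φ * ψ)(z) = ∑ aₙ Aₙ zⁿ` of `φ(z) = ∑ aₙ zⁿ` and
`ψ(z) = ∑ Aₙ zⁿ`; the series converges absolutely in the unit disk whenever `φ` and `ψ` are
analytic there. -/
noncomputable def conv (φ ψ : ℂ → ℂ) (z : ℂ) : ℂ :=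
  ∑' n : ℕ, taylorCoeff φ n * taylorCoeff ψ n * z ^ n

/-- The convolution `h * φ + conj (g * φ)` of the harmonic map `h + conj g` with the analytic
map `φ`. -/
noncomputable def harmonicConv (h g φ : ℂ → ℂ) (z : ℂ) : ℂ :=
  conv h φ z + conj (conv g φ z)

/-- `Ω` is convex in the direction `e^{iγ}`: every line parallel to the line through `0` and
`e^{iγ}` has connected or empty intersection with `Ω`. -/
def ConvexInDirection (γ : ℝ) (Ω : Set ℂ) : Prop :=
  ∀ w : ℂ, IsPreconnected
    (Ω ∩ Set.range fun t : ℝ => w + (t : ℂ) * Complex.exp (Complex.I * (γ : ℂ)))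

/-- `h + conj g` is a normalized harmonic map of the unit disk: `h(z) = z + ∑_{n ≥ 2} aₙ zⁿ` and
`g(z) = ∑_{n ≥ 1} bₙ zⁿ` are analytic in the disk. -/
structure IsNormalizedHarmonic (h g : ℂ → ℂ) : Prop where
  analytic_h : AnalyticOnNhd ℂ h unitDisk
  analytic_g : AnalyticOnNhd ℂ g unitDisk
  h_zero : h 0 = 0
  g_zero : g 0 = 0
  deriv_h_zero : deriv h 0 = 1

/-- The dilatation `g' / h'` is defined and has modulus less than `1` throughout the unit disk:
the harmonic map `h + conj g` is locally univalent and sense-preserving. -/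
def DilatationLtOne (h g : ℂ → ℂ) : Prop :=
  ∀ z ∈ unitDisk, deriv h z ≠ 0 ∧ ‖deriv g z / deriv h z‖ < 1

/-- The class `S`: normalized univalent analytic functions in the unit disk. -/
def classS : Set (ℂ → ℂ) :=
  {f | AnalyticOnNhd ℂ f unitDisk ∧ Set.InjOn f unitDisk ∧ f 0 = 0 ∧ deriv f 0 = 1}

/-- The class `S_H`: normalized univalent sense-preserving harmonic maps of the unit disk. -/
def classSH : Set (ℂ → ℂ) :=
  {f | ∃ h g : ℂ → ℂ, IsNormalizedHarmonic h g ∧ DilatationLtOne h g ∧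
    (∀ z ∈ unitDisk, f z = h z + conj (g z)) ∧ Set.InjOn f unitDisk}

/-- The class `K_γ`: functions in `S` whose image of the unit disk (automatically a domain) is
convex in the direction `e^{iγ}`. -/
def classK (γ : ℝ) : Set (ℂ → ℂ) :=
  {f | f ∈ classS ∧ ConvexInDirection γ (f '' unitDisk)}

/-- The class `K_{H(γ)}`: functions in `S_H` whose image of the unit disk (automatically a
domain) is convex in the direction `e^{iγ}`. -/
def classKH (γ : ℝ) : Set (ℂ → ℂ) :=
  {f | f ∈ classSH ∧ ConvexInDirection γ (f '' unitDisk)}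

/-- The class `DCP` of direction convexity preserving functions: `φ` is analytic in the unit disk
and for every direction `γ`, convolution with `φ` maps `K_γ` into itself. -/
def classDCP : Set (ℂ → ℂ) :=
  {φ | AnalyticOnNhd ℂ φ unitDisk ∧
    ∀ γ : ℝ, 0 ≤ γ → γ < Real.pi → ∀ f ∈ classK γ, conv φ f ∈ classK γ}

end HarmonicConvolution

/-! Write β = e^{iα}, d = e^{i(π/2-α)}, H = h * φ and G = g * φ. Since -d² = β⁻², the hypothesis
says that h - d²g is the half-plane map z/(1 - βz).

By the Clunie–Sheil-Small shear (`shear`), H + conj G is univalent with image convex along d once H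
- d²G is so and |G'| < |H'|. The first condition is quick: H - d²G is the convolution of φ with a
map onto a half-plane, which is convex in every direction, in particular along d, and φ preserves
this.

The dilatation bound is the real work. For each unimodular ε, h + εg is univalent and convex in some
direction depending on ε (`injOn_and_convexAlong_of_halfPlane`). Indeed (1 - βz)²(h' + εg') = (1 +
ηω)/(1 + ω) with ω = β⁻²g'/h' and η = εβ². For η ≠ 1 this stays in a half-plane bounded by a line
through 0, and a Royster–Ziegler type criterion (`injOn_and_convexAlong_of_re_pos`) applies. Hence H
+ εG is univalent, and H' + εG' has no zero for any unimodular ε. So |G'| = |H'| never occurs, and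
|G'| < |H'| spreads from the origin by connectedness.

The criterion is proved by moving to the right half-plane, where it concerns Q with Re Q' > 0.
Univalence is Noshiro–Warschawski. For horizontal convexity, Im Q increases strictly on vertical
lines, so each level set of Im Q is a graph over a set of abscissae; Harnack estimates show that
this set is an interval. -/

namespace HarmonicConvolution
open Set Filter Topology

/-! ### Convexity along a line: scaling and rotation. -/

/-- Convexity of `Ω` along the real line spanned by the complex number `d`. -/
def ConvexAlong (d : ℂ) (Ω : Set ℂ) : Prop :=
  ∀ w : ℂ, IsPreconnected (Ω ∩ Set.range fun t : ℝ => w + (t : ℂ) * d)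

theorem convexInDirection_iff {γ : ℝ} {Ω : Set ℂ} :
    ConvexInDirection γ Ω ↔ ConvexAlong (Complex.exp (Complex.I * (γ : ℂ))) Ω := Iff.rfl

theorem ConvexAlong.image_mul {d c : ℂ} {Ω : Set ℂ} (h : ConvexAlong d Ω) (hc : c ≠ 0) :
    ConvexAlong (c * d) ((fun z => c * z) '' Ω) := by
  intro w
  have : ((fun z => c * z) '' Ω) ∩ (Set.range fun t : ℝ => w + (t : ℂ) * (c * d)) =
      (fun z => c * z) '' (Ω ∩ Set.range fun t : ℝ => w / c + (t : ℂ) * d) := by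
    ext z
    constructor
    · rintro ⟨⟨y, hy, rfl⟩, t, ht⟩
      refine ⟨y, ⟨hy, t, ?_⟩, rfl⟩
      apply mul_left_cancel₀ hc
      simp only at ht ⊢
      rw [← ht]; field_simp
    · rintro ⟨y, ⟨hy, t, rfl⟩, rfl⟩
      refine ⟨⟨_, hy, rfl⟩, t, ?_⟩
      simp only
      field_simp
  rw [this]
  exact (h _).image _ (by fun_prop)

theorem ConvexAlong.real_mul {d : ℂ} {Ω : Set ℂ} (h : ConvexAlong d Ω) {r : ℝ} (hr : r ≠ 0) :
    ConvexAlong (r * d) Ω := by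
  intro w
  convert h w using 2
  have hr' : (r : ℂ) ≠ 0 := by exact_mod_cast hr
  ext z
  constructor
  · rintro ⟨t, rfl⟩
    exact ⟨t * r, by push_cast; ring⟩
  · rintro ⟨t, rfl⟩
    exact ⟨t / r, by push_cast; field_simp⟩

/-- Every line through the origin has a direction angle in `[0, π)`. -/
theorem exists_angle_eq_real_mul {d : ℂ} (hd : d ≠ 0) :
    ∃ γ r : ℝ, 0 ≤ γ ∧ γ < Real.pi ∧ r ≠ 0 ∧
      d = r * Complex.exp (Complex.I * (γ : ℂ)) := by
  have hn : ‖d‖ ≠ 0 := norm_ne_zero_iff.2 hd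
  have hrep := Complex.norm_mul_exp_arg_mul_I d
  have h1 := Complex.neg_pi_lt_arg d
  have h2 := Complex.arg_le_pi d
  have hpi := Real.pi_pos
  have hm : Complex.exp (Complex.I * Real.pi) = -1 := by
    rw [mul_comm]; exact Complex.exp_pi_mul_I
  rcases lt_or_ge (Complex.arg d) 0 with h | h
  · refine ⟨Complex.arg d + Real.pi, -‖d‖, by linarith, by linarith, by simpa using hd, ?_⟩
    push_cast
    rw [mul_add, Complex.exp_add, hm]
    conv_lhs => rw [← hrep]
    rw [mul_comm Complex.I]; ring
  · rcases h2.lt_or_eq with h3 | h3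
    · refine ⟨Complex.arg d, ‖d‖, h, h3, hn, ?_⟩
      rw [mul_comm Complex.I, hrep]
    · refine ⟨0, -‖d‖, le_rfl, hpi, by simpa using hd, ?_⟩
      conv_lhs => rw [← hrep, h3, Complex.exp_pi_mul_I]
      simp

theorem _root_.Convex.convexAlong {Ω : Set ℂ} (h : Convex ℝ Ω) (d : ℂ) : ConvexAlong d Ω := by
  intro w
  refine (h.inter ?_).isPreconnected
  rintro _ ⟨s, rfl⟩ _ ⟨t, rfl⟩ a b _ _ hab
  refine ⟨a * s + b * t, ?_⟩
  simp only [Complex.real_smul]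
  push_cast
  have : (a : ℂ) + b = 1 := by exact_mod_cast hab
  linear_combination (-w) * this

/-! ### Univalence implies a nonvanishing derivative. -/

/-- An analytic function that is injective near a point has nonzero derivative there. -/
theorem _root_.AnalyticAt.deriv_ne_zero_of_injOn {f : ℂ → ℂ} {z₀ : ℂ} {U : Set ℂ}
    (hf : AnalyticAt ℂ f z₀) (hU : U ∈ 𝓝 z₀) (hinj : InjOn f U) : deriv f z₀ ≠ 0 := by
  intro hd
  have hfs : AnalyticAt ℂ (fun z => f z - f z₀) z₀ := hf.sub analyticAt_const
  have hord : analyticOrderAt (fun z => f z - f z₀) z₀ ≠ ⊤ := by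
    intro htop
    rw [analyticOrderAt_eq_top] at htop
    have h1 : ∀ᶠ z in 𝓝[≠] z₀, f z - f z₀ = 0 ∧ z ∈ U :=
      (htop.and hU).filter_mono nhdsWithin_le_nhds
    obtain ⟨z, ⟨hz, hzU⟩, hne⟩ := (h1.and self_mem_nhdsWithin).exists
    exact hne (hinj hzU (mem_of_mem_nhds hU) (sub_eq_zero.1 hz))
  obtain ⟨k, hk, hk0, heq⟩ := hfs.analyticOrderAt_ne_top.1 hord
  set n := analyticOrderNatAt (fun z => f z - f z₀) z₀ with hn
  have hn2 : 2 ≤ n := by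
    by_contra hlt
    have : n = 0 ∨ n = 1 := by omega
    rcases this with h0 | h1
    · have := heq.self_of_nhds
      simp [h0] at this
      exact hk0 this.symm
    · have h2 : HasDerivAt (fun z => (z - z₀) ^ n • k z) (k z₀) z₀ := by
        have := ((hasDerivAt_id z₀).sub_const z₀).mul hk.differentiableAt.hasDerivAt
        simp only [h1, pow_one, smul_eq_mul]
        simpa using! this
      have h3 : HasDerivAt (fun z => f z - f z₀) (k z₀) z₀ := h2.congr_of_eventuallyEq heq
      have h4 := (hf.differentiableAt.hasDerivAt.sub_const (f z₀)).unique h3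
      exact hk0 (h4 ▸ hd)
  have hn0 : (n : ℂ) ≠ 0 := by exact_mod_cast (by omega : n ≠ 0)
  -- `l` is a local branch of the n-th root of k/k(z₀). Thus f - f(z₀) = k(z₀)ψⁿ near z₀ with ψ'(z₀)
  -- = 1. As n ≥ 2, values x ≠ 0 and ζx of ψ, with ζ a primitive n-th root of unity, come from
  -- distinct points at which f agrees.
  set l : ℂ → ℂ := fun z => Complex.exp (Complex.log (k z / k z₀) / n) with hl
  have hl_an : AnalyticAt ℂ l z₀ := by
    refine AnalyticAt.cexp (AnalyticAt.div (AnalyticAt.clog (hk.div_const) ?_)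
      analyticAt_const hn0)
    rw [div_self hk0]; exact Complex.one_mem_slitPlane
  have hl0 : l z₀ = 1 := by simp [hl, hk0]
  have hpow : ∀ᶠ z in 𝓝 z₀, k z = k z₀ * l z ^ n := by
    filter_upwards [hk.continuousAt.eventually_ne hk0] with z hz
    rw [hl, ← Complex.exp_nat_mul, mul_div_cancel₀ _ hn0, Complex.exp_log (div_ne_zero hz hk0)]
    field_simp
  set ψ : ℂ → ℂ := fun z => (z - z₀) * l z with hψ
  have hψ_an : AnalyticAt ℂ ψ z₀ := (analyticAt_id.sub analyticAt_const).mul hl_an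
  have hψd : HasStrictDerivAt ψ 1 z₀ := by
    have h1 : HasDerivAt ψ 1 z₀ := by
      have := ((hasDerivAt_id z₀).sub_const z₀).mul hl_an.differentiableAt.hasDerivAt
      simpa [hl0] using! this
    rw [← h1.deriv]
    exact hψ_an.hasStrictDerivAt
  have hmap := hψd.map_nhds_eq one_ne_zero
  have hψ0 : ψ z₀ = 0 := by simp [hψ]
  rw [hψ0] at hmap
  set V : Set ℂ := {z | z ∈ U ∧ f z - f z₀ = (z - z₀) ^ n • k z ∧ k z = k z₀ * l z ^ n}
  have hV : V ∈ 𝓝 z₀ := Filter.inter_mem hU (heq.and hpow)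
  have himg : ψ '' V ∈ 𝓝 (0 : ℂ) := by
    rw [← hmap]; exact image_mem_map hV
  have hζ := Complex.isPrimitiveRoot_exp n (by omega)
  set ζ : ℂ := Complex.exp (2 * Real.pi * Complex.I / n)
  have himg2 : ∀ᶠ x in 𝓝 (0 : ℂ), ζ * x ∈ ψ '' V := by
    have hc : Tendsto (fun x : ℂ => ζ * x) (𝓝 0) (𝓝 0) := by
      have : Continuous (fun x : ℂ => ζ * x) := by fun_prop
      simpa using this.tendsto 0
    exact hc himg
  have hev : ∀ᶠ x in 𝓝[≠] (0 : ℂ), x ∈ ψ '' V ∧ ζ * x ∈ ψ '' V :=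
    (Filter.inter_mem himg himg2 : _ ∈ 𝓝 (0 : ℂ)) |> nhdsWithin_le_nhds
  obtain ⟨x, ⟨⟨z, hz, hzx⟩, ⟨y, hy, hyx⟩⟩, hx⟩ := (hev.and self_mem_nhdsWithin).exists
  have hform : ∀ u ∈ V, f u - f z₀ = k z₀ * ψ u ^ n := by
    rintro u ⟨-, h1, h2⟩
    rw [h1, h2, hψ, smul_eq_mul, mul_pow]; ring
  have hfe : f y = f z := by
    have h1 := hform y hy
    have h2 := hform z hz
    rw [hyx, mul_pow, hζ.pow_eq_one, one_mul] at h1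
    rw [hzx] at h2
    exact sub_left_injective (h1.trans h2.symm)
  have hyz : y = z := hinj hy.1 hz.1 hfe
  rw [hyz, hzx] at hyx
  have h1 : ζ = 1 := by
    have := mul_right_cancel₀ hx ((one_mul x).trans hyx)
    exact this.symm
  exact hζ.ne_one (by omega) h1

/-! ### The shear construction. -/

theorem mem_unitDisk {z : ℂ} : z ∈ unitDisk ↔ ‖z‖ < 1 := mem_ball_zero_iff

theorem one_sub_mul_ne_zero {β : ℂ} (hβ : ‖β‖ = 1) {z : ℂ} (hz : z ∈ unitDisk) : 1 - β * z ≠ 0 := by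
  intro h0
  have h1 := congrArg norm (sub_eq_zero.1 h0)
  rw [norm_mul, hβ, norm_one, one_mul] at h1
  exact (mem_unitDisk.1 hz).ne h1.symm

/-- The quantity is Re((1 + X)/(1 - X)), and this Möbius map sends the unit disk to the right
half-plane. It serves both as the derivative of the shear along a line and in the half-plane map
computations. -/
theorem re_dilatation_pos {X : ℂ} (hX : ‖X‖ < 1) : 0 < 1 + 2 * (X / (1 - X)).re := by
  have h1 : (1 : ℂ) - X ≠ 0 := by
    intro h
    rw [sub_eq_zero] at h
    simp [← h] at hX
  have h2 : 0 < Complex.normSq (1 - X) := Complex.normSq_pos.2 h1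
  have h3 : X.re * X.re + X.im * X.im < 1 := by
    have := Complex.normSq_eq_norm_sq X
    rw [Complex.normSq_apply] at this
    rw [this]
    nlinarith [norm_nonneg X]
  rw [Complex.div_re, ← add_div, mul_div_assoc', ← sub_neg_eq_add, lt_sub_iff_add_lt, zero_add,
    ← neg_div, div_lt_one h2]
  simp only [Complex.sub_re, Complex.one_re, Complex.sub_im, Complex.one_im,
    Complex.normSq_apply]
  nlinarith

/-- The shear construction: if `h - d² g` is univalent with image convex along `d`, and
`h + conj g` is sense-preserving, then `h + conj g` is univalent with image convex along `d`. -/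
theorem shear {h g : ℂ → ℂ} {d : ℂ} (hd : ‖d‖ = 1) (hh : AnalyticOnNhd ℂ h unitDisk)
    (hg : AnalyticOnNhd ℂ g unitDisk) (hω : DilatationLtOne h g)
    (hinj : InjOn (fun z => h z - d ^ 2 * g z) unitDisk)
    (hconv : ConvexAlong d ((fun z => h z - d ^ 2 * g z) '' unitDisk)) :
    InjOn (fun z => h z + conj (g z)) unitDisk ∧
      ConvexAlong d ((fun z => h z + conj (g z)) '' unitDisk) := by
  set F : ℂ → ℂ := fun z => h z - d ^ 2 * g z with hF
  set k : ℂ → ℂ := Function.invFunOn F unitDisk with hk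
  have hkF : ∀ z ∈ unitDisk, k (F z) = z := fun z hz => hinj.leftInvOn_invFunOn hz
  have hdd : d * conj d = 1 := by rw [Complex.mul_conj']; simp [hd]
  have hd0 : d ≠ 0 := by rintro rfl; simp at hd
  -- The harmonic map differs from F by a real multiple of d, so it carries each slice of F(E) along
  -- d into the same line. There it acts as the real function `p w` on the parameter set `T w`, and
  -- everything reduces to `p w` being strictly increasing on an interval.
  have hshift : ∀ z, h z + conj (g z) = F z + ((2 * (d * g z).re : ℝ) : ℂ) * d := by
    intro z
    rw [← Complex.add_conj, map_mul, hF]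
    linear_combination (-conj (g z)) * hdd
  have hX : ∀ z ∈ unitDisk, ‖d ^ 2 * (deriv g z / deriv h z)‖ < 1 := by
    intro z hz
    rw [norm_mul, norm_pow, hd]; simpa using! (hω z hz).2
  have hF' : ∀ z ∈ unitDisk, HasStrictDerivAt F (deriv h z - d ^ 2 * deriv g z) z :=
    fun z hz => (hh z hz).hasStrictDerivAt.sub ((hg z hz).hasStrictDerivAt.const_mul _)
  have hF'0 : ∀ z ∈ unitDisk, deriv h z - d ^ 2 * deriv g z ≠ 0 := by
    intro z hz h0
    have h1 := hX z hz
    have h2 : d ^ 2 * (deriv g z / deriv h z) = 1 := by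
      have := (hω z hz).1
      field_simp
      linear_combination -h0
    simp [h2] at h1
  have hk' : ∀ z ∈ unitDisk,
      HasStrictDerivAt k (deriv h z - d ^ 2 * deriv g z)⁻¹ (F z) := by
    intro z hz
    refine (hF' z hz).to_local_left_inverse (hF'0 z hz) ?_
    filter_upwards [Metric.isOpen_ball.mem_nhds hz] with x hx using hkF x hx
  set T : ℂ → Set ℝ := fun w => {t | w + (t : ℂ) * d ∈ F '' unitDisk} with hT
  set p : ℂ → ℝ → ℝ := fun w t => t + 2 * (d * g (k (w + (t : ℂ) * d))).re with hp
  have hTpre : ∀ w, IsPreconnected (T w) := by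
    intro w
    have : T w = (fun u : ℂ => ((u - w) * conj d).re) ''
        (F '' unitDisk ∩ Set.range fun t : ℝ => w + (t : ℂ) * d) := by
      have key : ∀ t : ℝ, ((w + (t : ℂ) * d - w) * conj d).re = t := by
        intro t
        rw [add_sub_cancel_left, mul_assoc, hdd]; simp
      ext t
      constructor
      · intro ht
        exact ⟨_, ⟨ht, t, rfl⟩, key t⟩
      · rintro ⟨_, ⟨hu, s, rfl⟩, rfl⟩
        simp only [key]
        exact hu
    rw [this]
    exact (hconv w).image _ (by fun_prop)
  -- The derivative is 1 + 2 Re(X/(1 - X)) with X = d²g'/h', of modulus less than 1.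
  have hpd : ∀ w, ∀ t ∈ T w, ∃ p' : ℝ, 0 < p' ∧ HasDerivAt (p w) p' t := by
    rintro w t ⟨z, hz, hzt⟩
    have h1 : HasDerivAt (fun s : ℂ => w + s * d) d (t : ℂ) := by
      simpa using ((hasDerivAt_id (t : ℂ)).mul_const d).const_add w
    have h2 : HasDerivAt k (deriv h z - d ^ 2 * deriv g z)⁻¹ (w + (t : ℂ) * d) := by
      rw [← hzt]; exact (hk' z hz).hasDerivAt
    have h3 : HasDerivAt g (deriv g z) (k (w + (t : ℂ) * d)) := by
      rw [← hzt, hkF z hz]; exact (hg z hz).differentiableAt.hasDerivAt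
    have h4 := ((h3.comp (t : ℂ) (h2.comp (t : ℂ) h1)).const_mul d).real_of_complex
    refine ⟨_, ?_, (hasDerivAt_id t).add (h4.const_mul 2)⟩
    have h5 : d * (deriv g z * ((deriv h z - d ^ 2 * deriv g z)⁻¹ * d)) =
        d ^ 2 * (deriv g z / deriv h z) / (1 - d ^ 2 * (deriv g z / deriv h z)) := by
      have h6 := (hω z hz).1
      have h7 := hF'0 z hz
      have h8 : 1 - d ^ 2 * (deriv g z / deriv h z) =
          (deriv h z - d ^ 2 * deriv g z) / deriv h z := by field_simp
      rw [h8]; field_simp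
    rw [h5]
    exact re_dilatation_pos (hX z hz)
  have hpc : ∀ w, ContinuousOn (p w) (T w) := fun w t ht => by
    obtain ⟨p', -, hp'⟩ := hpd w t ht
    exact hp'.continuousAt.continuousWithinAt
  have hpm : ∀ w, StrictMonoOn (p w) (T w) := by
    intro w
    refine strictMonoOn_of_deriv_pos (hTpre w).ordConnected.convex (hpc w) fun t ht => ?_
    obtain ⟨p', h0, hp'⟩ := hpd w t (interior_subset ht)
    rw [hp'.deriv]; exact h0
  have hval : ∀ w, ∀ z ∈ unitDisk, ∀ t : ℝ, F z = w + (t : ℂ) * d →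
      h z + conj (g z) = w + (p w t : ℂ) * d := by
    intro w z hz t ht
    rw [hshift, hp]
    simp only
    rw [← ht, hkF z hz, ht]
    push_cast; ring
  constructor
  · intro z hz y hy hzy
    simp only at hzy
    have h1 : F z = F y + ((2 * (d * g y).re - 2 * (d * g z).re : ℝ) : ℂ) * d := by
      rw [hshift, hshift] at hzy
      push_cast at hzy ⊢
      linear_combination hzy
    have h2 : F y = F y + ((0 : ℝ) : ℂ) * d := by simp
    have h3 := hval _ z hz _ h1
    have h4 := hval _ y hy _ h2
    rw [hzy, h4] at h3
    have h5 : p (F y) 0 = p (F y) (2 * (d * g y).re - 2 * (d * g z).re) := by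
      exact_mod_cast mul_right_cancel₀ hd0 (add_left_cancel h3)
    have h6 := (hpm (F y)).injOn ⟨y, hy, h2⟩ ⟨z, hz, h1⟩ h5
    rw [← h6] at h1
    exact hinj hz hy (h1.trans h2.symm)
  · intro w
    have : (fun z => h z + conj (g z)) '' unitDisk ∩ (Set.range fun t : ℝ => w + (t : ℂ) * d) =
        (fun t : ℝ => w + (t : ℂ) * d) '' (p w '' T w) := by
      ext u
      constructor
      · rintro ⟨⟨z, hz, rfl⟩, s, hs⟩
        simp only at hs
        have h1 : F z = w + ((s - 2 * (d * g z).re : ℝ) : ℂ) * d := by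
          rw [hshift] at hs
          push_cast at hs ⊢
          linear_combination -hs
        exact ⟨_, ⟨_, ⟨z, hz, h1⟩, rfl⟩, (hval w z hz _ h1).symm⟩
      · rintro ⟨_, ⟨t, ⟨z, hz, hzt⟩, rfl⟩, rfl⟩
        exact ⟨⟨z, hz, hval w z hz t hzt⟩, _, rfl⟩
    rw [this]
    exact ((hTpre w).image _ (hpc w)).image _ (by fun_prop)

/-! ### Schwarz–Pick and Harnack estimates in the right half-plane. -/

/-- The right half-plane. -/
def rightHalfPlane : Set ℂ := {w | 0 < w.re}

theorem isOpen_rightHalfPlane : IsOpen rightHalfPlane :=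
  isOpen_lt continuous_const Complex.continuous_re

theorem convex_rightHalfPlane : Convex ℝ rightHalfPlane := convex_halfSpace_re_gt 0

theorem ofReal_add_mul_I_mem_rightHalfPlane {x : ℝ} (hx : 0 < x) (y : ℝ) :
    (x : ℂ) + y * Complex.I ∈ rightHalfPlane := by
  simpa [rightHalfPlane] using hx

/-- The Schwarz–Pick estimate for functions with positive real part in the right half-plane. -/
theorem norm_deriv_le_of_re_pos {P : ℂ → ℂ} (hP : DifferentiableOn ℂ P rightHalfPlane)
    (hpos : ∀ w ∈ rightHalfPlane, 0 < (P w).re) {w : ℂ} (hw : w ∈ rightHalfPlane) :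
    ‖deriv P w‖ ≤ 2 * (P w).re / w.re := by
  have hw' : 0 < w.re := hw
  have hsub : Metric.ball w w.re ⊆ rightHalfPlane := by
    intro z hz
    rw [Metric.mem_ball, dist_comm, dist_eq_norm] at hz
    have h1 := (Complex.re_le_norm (w - z)).trans_lt hz
    simp only [Complex.sub_re] at h1
    change 0 < z.re
    linarith
  have hden : ∀ z ∈ rightHalfPlane, P z + conj (P w) ≠ 0 := by
    intro z hz h0
    have h1 := congrArg Complex.re h0
    simp only [Complex.add_re, Complex.conj_re, Complex.zero_re] at h1
    linarith [hpos z hz, hpos w hw]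
  -- A Cayley transform of P sending P(w) to 0 and the right half-plane into the unit disk. The
  -- Schwarz lemma is applied on the ball of radius Re w about w, which lies in the half-plane.
  set S : ℂ → ℂ := fun z => (P z - P w) / (P z + conj (P w)) with hS
  have hSw : S w = 0 := by simp [hS]
  have hSd : DifferentiableOn ℂ S (Metric.ball w w.re) :=
    ((hP.sub_const _).div (hP.add_const _) hden).mono hsub
  have hmaps : MapsTo S (Metric.ball w w.re) (Metric.closedBall (S w) 1) := by
    intro z hz
    have hz' := hsub hz
    rw [hSw, mem_closedBall_zero_iff, hS, norm_div,
      div_le_one (norm_pos_iff.2 (hden z hz')), ← sq_le_sq₀ (norm_nonneg _) (norm_nonneg _),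
      ← Complex.normSq_eq_norm_sq, ← Complex.normSq_eq_norm_sq]
    simp only [Complex.normSq_apply, Complex.add_re, Complex.sub_re, Complex.add_im,
      Complex.sub_im, Complex.conj_re, Complex.conj_im]
    nlinarith [mul_pos (hpos z hz') (hpos w hw)]
  have h1 := Complex.norm_deriv_le_div_of_mapsTo_ball hSd hmaps hw'
  have hPw : HasDerivAt P (deriv P w) w :=
    ((hP w hw).differentiableAt (isOpen_rightHalfPlane.mem_nhds hw)).hasDerivAt
  have h2 : HasDerivAt S (deriv P w / ((2 * (P w).re : ℝ) : ℂ)) w := by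
    have := (hPw.sub_const (P w)).div (hPw.add_const (conj (P w))) (hden w hw)
    convert! this using 1
    rw [← Complex.add_conj]
    have := hden w hw
    field_simp
    ring
  have h3 : 0 < 2 * (P w).re := by linarith [hpos w hw]
  rw [h2.deriv, norm_div, Complex.norm_real, Real.norm_of_nonneg h3.le, div_le_iff₀ h3] at h1
  calc _ ≤ _ := h1
    _ = _ := by ring

theorem hasDerivAt_horizontal {P : ℂ → ℂ} (hP : DifferentiableOn ℂ P rightHalfPlane)
    {x : ℝ} (hx : 0 < x) (y : ℝ) :
    HasDerivAt (fun s : ℝ => P ((s : ℂ) + y * Complex.I))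
      (deriv P ((x : ℂ) + y * Complex.I)) x := by
  have hm := ofReal_add_mul_I_mem_rightHalfPlane hx y
  have h1 := ((hP _ hm).differentiableAt (isOpen_rightHalfPlane.mem_nhds hm)).hasDerivAt
  have h2 : HasDerivAt (fun s : ℝ => (s : ℂ) + y * Complex.I) 1 x :=
    (Complex.ofRealCLM.hasDerivAt (x := x)).add_const _
  simpa using! h1.comp x h2

theorem hasDerivAt_vertical {P : ℂ → ℂ} (hP : DifferentiableOn ℂ P rightHalfPlane)
    {x : ℝ} (hx : 0 < x) (y : ℝ) :
    HasDerivAt (fun s : ℝ => P ((x : ℂ) + s * Complex.I))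
      (deriv P ((x : ℂ) + y * Complex.I) * Complex.I) y := by
  have hm := ofReal_add_mul_I_mem_rightHalfPlane hx y
  have h1 := ((hP _ hm).differentiableAt (isOpen_rightHalfPlane.mem_nhds hm)).hasDerivAt
  have h2 : HasDerivAt (fun s : ℝ => (x : ℂ) + s * Complex.I) Complex.I y := by
    simpa using! ((Complex.ofRealCLM.hasDerivAt (x := y)).mul_const Complex.I).const_add (x : ℂ)
  exact h1.comp y h2

theorem hasDerivAt_vertical_im {Q : ℂ → ℂ} (hQ : DifferentiableOn ℂ Q rightHalfPlane)
    {x : ℝ} (hx : 0 < x) (y : ℝ) :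
    HasDerivAt (fun s : ℝ => (Q ((x : ℂ) + s * Complex.I)).im)
      (deriv Q ((x : ℂ) + y * Complex.I)).re y := by
  simpa using! (Complex.imCLM.hasFDerivAt (x := Q ((x : ℂ) + y * Complex.I))).comp_hasDerivAt y
    (hasDerivAt_vertical hQ hx y)

/-- A Harnack inequality along horizontal segments. -/
theorem re_le_of_re_pos {P : ℂ → ℂ} (hP : DifferentiableOn ℂ P rightHalfPlane)
    (hpos : ∀ w ∈ rightHalfPlane, 0 < (P w).re) {a b s x : ℝ} (ha : 0 < a)
    (hs : s ∈ Icc a b) (hx : x ∈ Icc a b) (y : ℝ) :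
    (P ((s : ℂ) + y * Complex.I)).re ≤ (b / a) ^ 2 * (P ((x : ℂ) + y * Complex.I)).re := by
  set v : ℝ → ℝ := fun s => (P ((s : ℂ) + y * Complex.I)).re with hv
  have hvd : ∀ t : ℝ, 0 < t → HasDerivAt v (deriv P ((t : ℂ) + y * Complex.I)).re t := by
    intro t ht
    exact (Complex.reCLM.hasFDerivAt (x := P ((t : ℂ) + y * Complex.I))).comp_hasDerivAt t
      (hasDerivAt_horizontal hP ht y)
  have hv0 : ∀ t : ℝ, 0 < t → 0 < v t := fun t ht =>
    hpos _ (ofReal_add_mul_I_mem_rightHalfPlane ht y)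
  have hbd : ∀ t : ℝ, 0 < t → |(deriv P ((t : ℂ) + y * Complex.I)).re| * t ≤ 2 * v t := by
    intro t ht
    have h1 := norm_deriv_le_of_re_pos hP hpos (ofReal_add_mul_I_mem_rightHalfPlane ht y)
    have h2 := (Complex.abs_re_le_norm _).trans h1
    simp only [Complex.add_re, Complex.ofReal_re, Complex.mul_re, Complex.I_re, mul_zero,
      Complex.ofReal_im, Complex.I_im, mul_one, sub_self, add_zero] at h2
    rwa [le_div_iff₀ ht] at h2
  -- The bound t|v'| ≤ 2v says exactly that v·t² increases and v/t² decreases; the two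
  -- monotonicities cover s ≤ x and x ≤ s.
  have hmono : MonotoneOn (fun t => v t * t ^ 2) (Ioi 0) := by
    have hd : ∀ t : ℝ, 0 < t → HasDerivAt (fun t => v t * t ^ 2)
        ((deriv P ((t : ℂ) + y * Complex.I)).re * t ^ 2 + v t * (2 * t)) t := by
      intro t ht
      simpa using! (hvd t ht).mul (hasDerivAt_pow 2 t)
    refine monotoneOn_of_deriv_nonneg (convex_Ioi 0)
      (fun t ht => (hd t ht).continuousAt.continuousWithinAt)
      (fun t ht => ((hd t (interior_subset ht)).differentiableAt.differentiableWithinAt)) ?_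
    intro t ht
    have ht' : 0 < t := interior_subset ht
    rw [(hd t ht').deriv]
    have h1 := hbd t ht'
    have h2 := mul_le_mul_of_nonneg_right (neg_abs_le (deriv P ((t : ℂ) + y * Complex.I)).re)
      ht'.le
    nlinarith
  have hanti : AntitoneOn (fun t => v t / t ^ 2) (Ioi 0) := by
    have hd : ∀ t : ℝ, 0 < t → HasDerivAt (fun t => v t / t ^ 2)
        (((deriv P ((t : ℂ) + y * Complex.I)).re * t ^ 2 - v t * (2 * t)) / (t ^ 2) ^ 2) t := by
      intro t ht
      simpa using! (hvd t ht).div (hasDerivAt_pow 2 t) (by positivity)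
    refine antitoneOn_of_deriv_nonpos (convex_Ioi 0)
      (fun t ht => (hd t ht).continuousAt.continuousWithinAt)
      (fun t ht => ((hd t (interior_subset ht)).differentiableAt.differentiableWithinAt)) ?_
    intro t ht
    have ht' : 0 < t := interior_subset ht
    rw [(hd t ht').deriv]
    refine div_nonpos_of_nonpos_of_nonneg ?_ (by positivity)
    have h1 := hbd t ht'
    have h2 := mul_le_mul_of_nonneg_right (le_abs_self (deriv P ((t : ℂ) + y * Complex.I)).re)
      ht'.le
    nlinarith
  have hs0 : 0 < s := ha.trans_le hs.1
  have hx0 : 0 < x := ha.trans_le hx.1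
  have hquot : ∀ p q : ℝ, 0 < p → p ≤ b → a ≤ q → (p / q) ^ 2 ≤ (b / a) ^ 2 := by
    intro p q hp hpb haq
    have : 0 < q := ha.trans_le haq
    have : 0 < b := hp.trans_le hpb
    gcongr
  change v s ≤ (b / a) ^ 2 * v x
  rcases le_total s x with h | h
  · have h1 : v s * s ^ 2 ≤ v x * x ^ 2 := hmono hs0 hx0 h
    have h2 := mul_le_mul_of_nonneg_right (hquot x s hx0 hx.2 hs.1) (hv0 x hx0).le
    refine le_trans ?_ h2
    rw [div_pow, div_mul_eq_mul_div, le_div_iff₀ (by positivity)]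
    linarith
  · have h1 : v s / s ^ 2 ≤ v x / x ^ 2 := hanti hx0 hs0 h
    have h2 := mul_le_mul_of_nonneg_right (hquot s x hs0 hs.2 hx.1) (hv0 x hx0).le
    refine le_trans ?_ h2
    rw [div_le_div_iff₀ (by positivity) (by positivity)] at h1
    rw [div_pow, div_mul_eq_mul_div, le_div_iff₀ (by positivity)]
    linarith

/-- If `Re Q' > 0`, the second difference of `Q` along a horizontal segment is controlled by
`Re Q'` at a point of the segment, uniformly in the height of the segment. -/
theorem exists_norm_sub_sub_le {Q : ℂ → ℂ} (hQ : DifferentiableOn ℂ Q rightHalfPlane)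
    (hpos : ∀ w ∈ rightHalfPlane, 0 < (deriv Q w).re) {a b x : ℝ} (ha : 0 < a)
    (hx : x ∈ Icc a b) :
    ∃ K : ℝ, 0 ≤ K ∧ ∀ y : ℝ, ∀ s ∈ Icc a b,
      ‖Q ((s : ℂ) + y * Complex.I) - Q ((x : ℂ) + y * Complex.I) -
        ((s - x : ℝ) : ℂ) * deriv Q ((x : ℂ) + y * Complex.I)‖ ≤
        K * (deriv Q ((x : ℂ) + y * Complex.I)).re := by
  have hP : DifferentiableOn ℂ (deriv Q) rightHalfPlane := hQ.deriv isOpen_rightHalfPlane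
  have hb : 0 < b := ha.trans_le (hx.1.trans hx.2)
  -- Schwarz–Pick and Harnack bound |Q''| on the segment by 2(b/a)²/a times Re Q' at x; two mean
  -- value inequalities each contribute a factor b - a.
  refine ⟨2 * (b / a) ^ 2 / a * (b - a) * (b - a), ?_, ?_⟩
  · have : 0 ≤ b - a := by linarith [hx.1, hx.2]
    positivity
  intro y s hs
  have hx0 : 0 < x := ha.trans_le hx.1
  set R := (deriv Q ((x : ℂ) + y * Complex.I)).re with hR
  have hR0 : 0 < R := hpos _ (ofReal_add_mul_I_mem_rightHalfPlane hx0 y)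
  have hab : ∀ t ∈ Icc a b, |t - x| ≤ b - a := fun t ht => by
    rw [abs_le]; constructor <;> linarith [ht.1, ht.2, hx.1, hx.2]
  have hP' : ∀ t ∈ Icc a b,
      ‖deriv (deriv Q) ((t : ℂ) + y * Complex.I)‖ ≤ 2 * (b / a) ^ 2 / a * R := by
    intro t ht
    have ht0 : 0 < t := ha.trans_le ht.1
    have h1 := norm_deriv_le_of_re_pos hP hpos (ofReal_add_mul_I_mem_rightHalfPlane ht0 y)
    have h2 := re_le_of_re_pos hP hpos ha ht hx y
    simp only [Complex.add_re (t : ℂ), Complex.ofReal_re, Complex.mul_re, Complex.I_re, mul_zero,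
      Complex.ofReal_im, Complex.I_im, mul_one, sub_self, add_zero] at h1
    refine h1.trans ?_
    calc 2 * (deriv Q ((t : ℂ) + y * Complex.I)).re / t
        ≤ 2 * ((b / a) ^ 2 * R) / a := by
          gcongr
          exact ht.1
      _ = _ := by ring
  have hP1 : ∀ t ∈ Icc a b, ‖deriv Q ((t : ℂ) + y * Complex.I) -
      deriv Q ((x : ℂ) + y * Complex.I)‖ ≤ 2 * (b / a) ^ 2 / a * R * (b - a) := by
    intro t ht
    have h1 := (convex_Icc a b).norm_image_sub_le_of_norm_hasDerivWithin_le
      (fun u hu => (hasDerivAt_horizontal hP (ha.trans_le hu.1) y).hasDerivWithinAt) hP' hx ht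
    refine h1.trans ?_
    rw [Real.norm_eq_abs]
    gcongr
    exact hab t ht
  have h1 := (convex_Icc a b).norm_image_sub_le_of_norm_hasDerivWithin_le
    (f := fun u : ℝ => Q ((u : ℂ) + y * Complex.I) -
      (u : ℂ) * deriv Q ((x : ℂ) + y * Complex.I))
    (fun u hu => ((hasDerivAt_horizontal hQ (ha.trans_le hu.1) y).sub
      ((Complex.ofRealCLM.hasDerivAt (x := u)).mul_const
        (deriv Q ((x : ℂ) + y * Complex.I)))).hasDerivWithinAt)
    (fun u hu => by simpa using hP1 u hu) hx hs
  calc _ = _ := by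
        congr 1
        push_cast
        ring
    _ ≤ _ := h1
    _ ≤ 2 * (b / a) ^ 2 / a * R * (b - a) * (b - a) := by
        have : 0 ≤ b - a := by linarith [hx.1, hx.2]
        rw [Real.norm_eq_abs]
        gcongr
        exact hab s hs
    _ = _ := by ring

/-! ### Level sets of Im Q and horizontal convexity. -/

/-- A function on the line whose derivative is bounded below by a positive constant from some
point on is unbounded above. -/
theorem exists_lt_of_le_hasDerivAt {u u' : ℝ → ℝ} {δ Y : ℝ} (hδ : 0 < δ)
    (hu : ∀ y, HasDerivAt u (u' y) y) (hle : ∀ y ≥ Y, δ ≤ u' y) (M : ℝ) :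
    ∃ y ≥ Y, M < u y := by
  have hcv : MonotoneOn (fun y => u y - δ * y) (Ici Y) := by
    have hd : ∀ y, HasDerivAt (fun y => u y - δ * y) (u' y - δ) y := fun y => by
      simpa using! (hu y).sub ((hasDerivAt_id y).const_mul δ)
    refine monotoneOn_of_deriv_nonneg (convex_Ici Y)
      (fun t _ => (hd t).continuousAt.continuousWithinAt)
      (fun t _ => ((hd t).differentiableAt.differentiableWithinAt)) ?_
    intro t ht
    rw [(hd t).deriv]
    linarith [hle t (interior_subset ht)]
  obtain ⟨n, hn⟩ := exists_nat_gt ((M - u Y) / δ)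
  have h1 := hcv (self_mem_Ici) (show Y + n ∈ Ici Y by simp) (by simp)
  simp only at h1
  refine ⟨Y + n, by simp, ?_⟩
  rw [div_lt_iff₀ hδ] at hn
  nlinarith

/-- If `ux` stayed below v, then beyond both `ya` and `yb` the weighted sum would exceed a fixed δ >
0, so R = ux' would be bounded below and `ux` would be unbounded above. -/
theorem exists_le_of_abs_weighted_sub_le {ua ub ux R : ℝ → ℝ} {p q C v ya yb : ℝ}
    (hp : 0 < p) (hq : 0 < q) (hC : 0 ≤ C) (hua : StrictMono ua) (hub : StrictMono ub)
    (hux : ∀ y, HasDerivAt ux (R y) y) (hR : ∀ y, 0 < R y)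
    (hle : ∀ y, |p * (ua y - ux y) + q * (ub y - ux y)| ≤ C * R y)
    (hya : ua ya = v) (hyb : ub yb = v) : ∃ y, v ≤ ux y := by
  by_contra! hlt
  have ha : v < ua (ya + 1) := hya ▸ hua (lt_add_one ya)
  have hb : v < ub (yb + 1) := hyb ▸ hub (lt_add_one yb)
  set δ := p * (ua (ya + 1) - v) + q * (ub (yb + 1) - v) with hδ
  have hδ0 : 0 < δ := by
    have := mul_pos hp (sub_pos.2 ha)
    have := mul_pos hq (sub_pos.2 hb)
    positivity
  -- C may be 0, so C + 1 is used as divisor.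
  have hC1 : 0 < C + 1 := by linarith
  obtain ⟨y, -, hy⟩ := exists_lt_of_le_hasDerivAt (Y := max ya yb + 1) (div_pos hδ0 hC1) hux
    (fun y hy => by
      rw [div_le_iff₀ hC1]
      have h1 : ua (ya + 1) ≤ ua y :=
        hua.monotone (by linarith [le_max_left ya yb])
      have h2 : ub (yb + 1) ≤ ub y :=
        hub.monotone (by linarith [le_max_right ya yb])
      have h3 := (le_abs_self _).trans (hle y)
      have h4 := hlt y
      have h5 : p * (ua (ya + 1) - v) ≤ p * (ua y - ux y) := by gcongr
      have h6 : q * (ub (yb + 1) - v) ≤ q * (ub y - ux y) := by gcongr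
      have h7 := hR y
      rw [hδ]
      linarith) v
  exact absurd (hlt y) hy.not_gt

variable {Q : ℂ → ℂ}

theorem strictMono_vertical_im (hQ : DifferentiableOn ℂ Q rightHalfPlane)
    (hpos : ∀ w ∈ rightHalfPlane, 0 < (deriv Q w).re) {x : ℝ} (hx : 0 < x) :
    StrictMono fun y : ℝ => (Q ((x : ℂ) + y * Complex.I)).im := by
  refine strictMono_of_deriv_pos fun y => ?_
  rw [(hasDerivAt_vertical_im hQ hx y).deriv]
  exact hpos _ (ofReal_add_mul_I_mem_rightHalfPlane hx y)

/-- The vertical lines whose image under `Q` meets a fixed horizontal line form an interval. -/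
theorem ordConnected_setOf_exists_im_eq (hQ : DifferentiableOn ℂ Q rightHalfPlane)
    (hpos : ∀ w ∈ rightHalfPlane, 0 < (deriv Q w).re) (v : ℝ) :
    OrdConnected {x : ℝ | 0 < x ∧ ∃ y : ℝ, (Q ((x : ℂ) + y * Complex.I)).im = v} := by
  refine ⟨?_⟩
  rintro a ⟨ha, ya, hya⟩ b ⟨hb, yb, hyb⟩ x hx
  have hx0 : 0 < x := ha.trans_le hx.1
  refine ⟨hx0, ?_⟩
  rcases hx.1.eq_or_lt with rfl | hax
  · exact ⟨ya, hya⟩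
  rcases hx.2.eq_or_lt with rfl | hxb
  · exact ⟨yb, hyb⟩
  obtain ⟨K, hK0, hK⟩ := exists_norm_sub_sub_le hQ hpos ha hx
  set u : ℝ → ℝ → ℝ := fun s y => (Q ((s : ℂ) + y * Complex.I)).im with hu
  set R : ℝ → ℝ := fun y => (deriv Q ((x : ℂ) + y * Complex.I)).re with hR
  have hR0 : ∀ y, 0 < R y := fun y => hpos _ (ofReal_add_mul_I_mem_rightHalfPlane hx0 y)
  have hux : ∀ y, HasDerivAt (u x) (R y) y := hasDerivAt_vertical_im hQ hx0
  have hua : StrictMono (u a) := strictMono_vertical_im hQ hpos ha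
  have hub : StrictMono (u b) := strictMono_vertical_im hQ hpos hb
  have him : ∀ y, ∀ s ∈ Icc a b, |u s y - u x y -
      (s - x) * (deriv Q ((x : ℂ) + y * Complex.I)).im| ≤ K * R y := by
    intro y s hs
    refine le_trans (le_of_eq ?_) ((Complex.abs_im_le_norm _).trans (hK y s hs))
    rw [Complex.sub_im, Complex.sub_im, Complex.im_ofReal_mul]
  -- The weights b - x and x - a cancel the first-order terms in Im Q', which are not controlled by
  -- Re Q'.
  have hD : ∀ y, |(b - x) * (u a y - u x y) + (x - a) * (u b y - u x y)| ≤
      (K * (b - a)) * R y := by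
    intro y
    have h1 := abs_le.1 (him y a ⟨le_rfl, hx.1.trans hx.2⟩)
    have h2 := abs_le.1 (him y b ⟨hx.1.trans hx.2, le_rfl⟩)
    have h3 : 0 ≤ b - x := by linarith
    have h4 : 0 ≤ x - a := by linarith
    rw [abs_le]
    constructor <;> nlinarith [mul_le_mul_of_nonneg_left h1.1 h3,
      mul_le_mul_of_nonneg_left h1.2 h3, mul_le_mul_of_nonneg_left h2.1 h4,
      mul_le_mul_of_nonneg_left h2.2 h4]
  have hC : 0 ≤ K * (b - a) := mul_nonneg hK0 (by linarith)
  obtain ⟨y₁, hy₁⟩ := exists_le_of_abs_weighted_sub_le (sub_pos.2 hxb) (sub_pos.2 hax) hC hua hub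
    hux hR0 hD hya hyb
  -- The reflection y ↦ -y, u ↦ -u gives a point where `u x` is at most v; the intermediate value
  -- theorem then concludes.
  have hneg : ∀ {w : ℝ → ℝ}, StrictMono w → StrictMono fun y => -w (-y) :=
    fun hw y z hyz => neg_lt_neg (hw (neg_lt_neg hyz))
  obtain ⟨y₂, hy₂⟩ := exists_le_of_abs_weighted_sub_le (ua := fun y => -u a (-y))
    (ub := fun y => -u b (-y)) (ux := fun y => -u x (-y)) (R := fun y => R (-y)) (v := -v)
    (ya := -ya) (yb := -yb) (sub_pos.2 hxb) (sub_pos.2 hax) hC (hneg hua) (hneg hub)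
    (fun y => by
      have := ((hux (-y)).comp y (hasDerivAt_neg y)).neg
      simpa using! this)
    (fun y => hR0 _)
    (fun y => by
      refine le_trans (le_of_eq ?_) (hD (-y))
      rw [← abs_neg]
      congr 1
      ring)
    (by simpa using hya) (by simpa using hyb)
  have hcont : Continuous (u x) := continuous_iff_continuousAt.2 fun y => (hux y).continuousAt
  obtain ⟨y, hy⟩ := mem_range_of_exists_le_of_exists_ge hcont
    ⟨-y₂, show u x (-y₂) ≤ v by linarith⟩ ⟨y₁, hy₁⟩
  exact ⟨y, hy⟩

/-- The level sets of `Im Q` in the right half-plane are connected when `Re Q' > 0`. -/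
theorem isPreconnected_im_eq (hQ : DifferentiableOn ℂ Q rightHalfPlane)
    (hpos : ∀ w ∈ rightHalfPlane, 0 < (deriv Q w).re) (v : ℝ) :
    IsPreconnected {w | w ∈ rightHalfPlane ∧ (Q w).im = v} := by
  set S : Set ℝ := {x : ℝ | 0 < x ∧ ∃ y : ℝ, (Q ((x : ℂ) + y * Complex.I)).im = v} with hS
  -- `Y` is the height of the level set over x; its values off `S` play no role.
  have hex : ∀ x, ∃ y : ℝ, x ∈ S → (Q ((x : ℂ) + y * Complex.I)).im = v := by
    intro x
    by_cases hx : x ∈ S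
    · obtain ⟨y, hy⟩ := hx.2
      exact ⟨y, fun _ => hy⟩
    · exact ⟨0, fun h => absurd h hx⟩
  choose Y hY using hex
  have hcontQ : ∀ x : ℝ, 0 < x → ∀ y : ℝ,
      ContinuousAt (fun s : ℝ => (Q ((s : ℂ) + y * Complex.I)).im) x := fun x hx y =>
    Complex.continuous_im.continuousAt.comp (hasDerivAt_horizontal hQ hx y).continuousAt
  -- A strict inequality between Im Q and v at a fixed height persists for nearby abscissae, and
  -- vertical monotonicity turns it into a bound on `Y`.
  have hYc : ContinuousOn Y S := by
    intro x hx
    have hmono := strictMono_vertical_im hQ hpos hx.1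
    rw [ContinuousWithinAt, tendsto_order]
    constructor
    · intro y hy
      have h1 : (Q ((x : ℂ) + y * Complex.I)).im < v := hY x hx ▸ hmono hy
      have h2 := ((hcontQ x hx.1 y).eventually_lt_const h1).filter_mono
        (nhdsWithin_le_nhds (s := S))
      filter_upwards [h2, self_mem_nhdsWithin] with s hs hsS
      rw [← hY s hsS] at hs
      exact (strictMono_vertical_im hQ hpos hsS.1).lt_iff_lt.1 hs
    · intro y hy
      have h1 : v < (Q ((x : ℂ) + y * Complex.I)).im := by
        conv_lhs => rw [← hY x hx]
        exact hmono hy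
      have h2 := ((hcontQ x hx.1 y).eventually_const_lt h1).filter_mono
        (nhdsWithin_le_nhds (s := S))
      filter_upwards [h2, self_mem_nhdsWithin] with s hs hsS
      rw [← hY s hsS] at hs
      exact (strictMono_vertical_im hQ hpos hsS.1).lt_iff_lt.1 hs
  have himage : {w | w ∈ rightHalfPlane ∧ (Q w).im = v} =
      (fun x : ℝ => (x : ℂ) + Y x * Complex.I) '' S := by
    ext w
    constructor
    · rintro ⟨hw, hwv⟩
      have hwS : w.re ∈ S := ⟨hw, w.im, by rwa [Complex.re_add_im]⟩
      refine ⟨w.re, hwS, ?_⟩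
      have h1 : (Q ((w.re : ℂ) + w.im * Complex.I)).im = v := by rwa [Complex.re_add_im]
      have h2 := (strictMono_vertical_im hQ hpos hw).injective ((hY _ hwS).trans h1.symm)
      simp only
      rw [h2, Complex.re_add_im]
    · rintro ⟨x, hx, rfl⟩
      exact ⟨ofReal_add_mul_I_mem_rightHalfPlane hx.1 _, hY x hx⟩
  rw [himage]
  refine (ordConnected_setOf_exists_im_eq hQ hpos v).isPreconnected.image _ ?_
  exact Complex.continuous_ofReal.continuousOn.add
    ((Complex.continuous_ofReal.comp_continuousOn hYc).mul continuousOn_const)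

theorem convexAlong_image_rightHalfPlane (hQ : DifferentiableOn ℂ Q rightHalfPlane)
    (hpos : ∀ w ∈ rightHalfPlane, 0 < (deriv Q w).re) :
    ConvexAlong 1 (Q '' rightHalfPlane) := by
  intro c
  have : Q '' rightHalfPlane ∩ (Set.range fun t : ℝ => c + (t : ℂ) * 1) =
      Q '' {w | w ∈ rightHalfPlane ∧ (Q w).im = c.im} := by
    ext z
    constructor
    · rintro ⟨⟨w, hw, rfl⟩, t, ht⟩
      exact ⟨w, ⟨hw, by rw [← ht]; simp⟩, rfl⟩
    · rintro ⟨w, ⟨hw, hwc⟩, rfl⟩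
      refine ⟨⟨w, hw, rfl⟩, (Q w).re - c.re, ?_⟩
      apply Complex.ext <;> simp [hwc]
  rw [this]
  exact (isPreconnected_im_eq hQ hpos _).image _ (hQ.continuousOn.mono fun w hw => hw.1)

/-! ### Univalence and the Royster–Ziegler type criterion. -/

/-- The Noshiro–Warschawski theorem for the right half-plane. -/
theorem injOn_of_re_deriv_pos (hQ : DifferentiableOn ℂ Q rightHalfPlane)
    (hpos : ∀ w ∈ rightHalfPlane, 0 < (deriv Q w).re) : InjOn Q rightHalfPlane := by
  intro a ha b hb hab
  by_contra hne
  -- The derivative of `r` is |b - a|² Re Q' > 0, whereas Q(a) = Q(b) would force r(0) = r(1).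
  set r : ℝ → ℝ := fun t => (conj (b - a) * Q (a + (t : ℂ) * (b - a))).re with hr
  have hmem : ∀ t ∈ Icc (0 : ℝ) 1, a + (t : ℂ) * (b - a) ∈ rightHalfPlane := by
    intro t ht
    have := convex_rightHalfPlane.add_smul_sub_mem ha hb ht
    rwa [Complex.real_smul] at this
  have hrd : ∀ t ∈ Icc (0 : ℝ) 1, HasDerivAt r
      (conj (b - a) * (deriv Q (a + (t : ℂ) * (b - a)) * (b - a))).re t := by
    intro t ht
    have hm := hmem t ht
    have h1 : HasDerivAt (fun s : ℂ => a + s * (b - a)) (b - a) (t : ℂ) := by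
      simpa using ((hasDerivAt_id (t : ℂ)).mul_const (b - a)).const_add a
    have h2 := ((hQ _ hm).differentiableAt (isOpen_rightHalfPlane.mem_nhds hm)).hasDerivAt
    exact ((h2.comp (t : ℂ) h1).const_mul (conj (b - a))).real_of_complex
  have hmono : StrictMonoOn r (Icc 0 1) := by
    refine strictMonoOn_of_deriv_pos (convex_Icc 0 1)
      (fun t ht => (hrd t ht).continuousAt.continuousWithinAt) fun t ht => ?_
    have ht' := interior_subset ht
    rw [(hrd t ht').deriv]
    have h1 : conj (b - a) * (deriv Q (a + (t : ℂ) * (b - a)) * (b - a)) =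
        ((Complex.normSq (b - a) : ℝ) : ℂ) * deriv Q (a + (t : ℂ) * (b - a)) := by
      rw [Complex.normSq_eq_conj_mul_self]; ring
    rw [h1, Complex.re_ofReal_mul]
    exact mul_pos (Complex.normSq_pos.2 (sub_ne_zero.2 (Ne.symm hne))) (hpos _ (hmem t ht'))
  have h1 := hmono (left_mem_Icc.2 zero_le_one) (right_mem_Icc.2 zero_le_one) zero_lt_one
  simp [hr, hab] at h1

/-- A Royster–Ziegler type criterion: if `Re (c (1 - βz)² F'(z)) > 0` in the disk, where
`|β| = 1`, then `F` is univalent and its image is convex along some line. -/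
theorem injOn_and_convexAlong_of_re_pos {F : ℂ → ℂ} {β c : ℂ} (hβ : ‖β‖ = 1)
    (hF : AnalyticOnNhd ℂ F unitDisk)
    (hpos : ∀ z ∈ unitDisk, 0 < (c * ((1 - β * z) ^ 2 * deriv F z)).re) :
    InjOn F unitDisk ∧ ∃ d ≠ 0, ConvexAlong d (F '' unitDisk) := by
  have hβ0 : β ≠ 0 := by rintro rfl; simp at hβ
  have hc0 : c ≠ 0 := by
    rintro rfl
    simpa using hpos 0 (by simp)
  have hsub0 : ∀ z ∈ unitDisk, 1 - β * z ≠ 0 := fun z hz => one_sub_mul_ne_zero hβ hz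
  have hadd0 : ∀ w ∈ rightHalfPlane, w + 1 ≠ 0 := by
    intro w hw h0
    have h1 := congrArg Complex.re h0
    simp only [Complex.add_re, Complex.one_re, Complex.zero_re] at h1
    have : 0 < w.re := hw
    linarith
  set m : ℂ → ℂ := fun w => β⁻¹ * ((w - 1) / (w + 1)) with hm
  have hmaps : ∀ w ∈ rightHalfPlane, m w ∈ unitDisk := by
    intro w hw
    have hw' : 0 < w.re := hw
    rw [mem_ball_zero_iff, hm, norm_mul, norm_inv, hβ, inv_one, one_mul, norm_div,
      div_lt_one (norm_pos_iff.2 (hadd0 w hw)), ← sq_lt_sq₀ (norm_nonneg _) (norm_nonneg _),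
      ← Complex.normSq_eq_norm_sq, ← Complex.normSq_eq_norm_sq]
    simp only [Complex.normSq_apply, Complex.add_re, Complex.sub_re, Complex.add_im,
      Complex.sub_im, Complex.one_re, Complex.one_im]
    nlinarith
  have hsurj : ∀ z ∈ unitDisk, ∃ w ∈ rightHalfPlane, m w = z := by
    intro z hz
    have h0 := hsub0 z hz
    refine ⟨(1 + β * z) / (1 - β * z), ?_, ?_⟩
    · change 0 < ((1 + β * z) / (1 - β * z)).re
      have h1 : ‖β * z‖ < 1 := by
        rw [norm_mul, hβ, one_mul]; exact mem_ball_zero_iff.1 hz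
      have h2 := re_dilatation_pos h1
      have h3 : (1 + β * z) / (1 - β * z) = 1 + ((2 : ℝ) : ℂ) * (β * z / (1 - β * z)) := by
        field_simp; push_cast; ring
      rw [h3, Complex.add_re, Complex.re_ofReal_mul]
      exact h2
    · simp only [hm]
      have h4 : (1 + β * z) / (1 - β * z) - 1 = 2 * (β * z) / (1 - β * z) := by
        field_simp; ring
      have h5 : (1 + β * z) / (1 - β * z) + 1 = 2 / (1 - β * z) := by
        field_simp; ring
      rw [h4, h5]
      field_simp
  have hm' : ∀ w ∈ rightHalfPlane, HasDerivAt m (β⁻¹ * (2 / (w + 1) ^ 2)) w := by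
    intro w hw
    have h0 := hadd0 w hw
    have := ((((hasDerivAt_id w).sub_const 1).div ((hasDerivAt_id w).add_const 1) h0).const_mul
      β⁻¹)
    convert! this using 2
    simp only [id]
    ring
  -- Since m' = (1 - βm)²/(2β), this factor makes Q' equal to the expression assumed to have
  -- positive real part.
  set Q : ℂ → ℂ := fun w => 2 * c * β * F (m w) with hQ
  have hQ' : ∀ w ∈ rightHalfPlane, HasDerivAt Q
      (c * ((1 - β * m w) ^ 2 * deriv F (m w))) w := by
    intro w hw
    have h1 := ((hF _ (hmaps w hw)).differentiableAt.hasDerivAt.comp w (hm' w hw)).const_mul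
      (2 * c * β)
    convert! h1 using 1
    have h2 : 1 - β * m w = 2 / (w + 1) := by
      have := hadd0 w hw
      simp only [hm]
      field_simp
      ring
    rw [h2]
    field_simp
  have hQd : DifferentiableOn ℂ Q rightHalfPlane :=
    fun w hw => (hQ' w hw).differentiableAt.differentiableWithinAt
  have hQpos : ∀ w ∈ rightHalfPlane, 0 < (deriv Q w).re := fun w hw => by
    rw [(hQ' w hw).deriv]; exact hpos _ (hmaps w hw)
  have hA : 2 * c * β ≠ 0 := by simp [hc0, hβ0]
  constructor
  · intro z hz y hy hzy
    obtain ⟨w, hw, rfl⟩ := hsurj z hz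
    obtain ⟨x, hx, rfl⟩ := hsurj y hy
    rw [injOn_of_re_deriv_pos hQd hQpos hw hx (by simp only [hQ]; rw [hzy])]
  · refine ⟨(2 * c * β)⁻¹ * 1, mul_ne_zero (inv_ne_zero hA) one_ne_zero, ?_⟩
    have himg : F '' unitDisk = (fun z => (2 * c * β)⁻¹ * z) '' (Q '' rightHalfPlane) := by
      ext u
      constructor
      · rintro ⟨z, hz, rfl⟩
        obtain ⟨w, hw, rfl⟩ := hsurj z hz
        exact ⟨_, ⟨w, hw, rfl⟩, inv_mul_cancel_left₀ hA _⟩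
      · rintro ⟨_, ⟨w, hw, rfl⟩, rfl⟩
        exact ⟨m w, hmaps w hw, (inv_mul_cancel_left₀ hA _).symm⟩
    rw [himg]
    exact (convexAlong_image_rightHalfPlane hQd hQpos).image_mul (inv_ne_zero hA)

/-! ### Hadamard products and the action of DCP functions. -/

theorem unitDisk_mem_nhds_zero : unitDisk ∈ 𝓝 (0 : ℂ) := Metric.ball_mem_nhds _ one_pos

theorem taylorCoeff_zero (f : ℂ → ℂ) : taylorCoeff f 0 = f 0 := by simp [taylorCoeff]

theorem taylorCoeff_one (f : ℂ → ℂ) : taylorCoeff f 1 = deriv f 0 := by simp [taylorCoeff]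

theorem taylorCoeff_const_mul (c : ℂ) (f : ℂ → ℂ) (n : ℕ) :
    taylorCoeff (fun z => c * f z) n = c * taylorCoeff f n := by
  rw [taylorCoeff, taylorCoeff, iteratedDeriv_const_mul_field, mul_div_assoc]

theorem taylorCoeff_add {f g : ℂ → ℂ} (hf : AnalyticAt ℂ f 0) (hg : AnalyticAt ℂ g 0) (n : ℕ) :
    taylorCoeff (fun z => f z + g z) n = taylorCoeff f n + taylorCoeff g n := by
  have := iteratedDeriv_add (n := n) hf.contDiffAt hg.contDiffAt
  simp only [taylorCoeff]
  rw [← add_div, ← this]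
  rfl

theorem summable_norm_taylorCoeff {f : ℂ → ℂ} (hf : AnalyticOnNhd ℂ f unitDisk) {r : ℝ}
    (hr0 : 0 ≤ r) (hr : r < 1) : Summable fun n => ‖taylorCoeff f n‖ * r ^ n := by
  have hz : (r : ℂ) ∈ unitDisk := by
    rw [mem_unitDisk, Complex.norm_real, Real.norm_of_nonneg hr0]; exact hr
  have h1 := (Complex.hasSum_taylorSeries_on_ball hf.differentiableOn hz).summable.norm
  refine h1.congr fun n => ?_
  rw [sub_zero, norm_smul, norm_smul, norm_pow, Complex.norm_real, Real.norm_of_nonneg hr0,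
    taylorCoeff, norm_div, norm_inv]
  ring

theorem summable_norm_taylorCoeff_mul {f g : ℂ → ℂ} (hf : AnalyticOnNhd ℂ f unitDisk)
    (hg : AnalyticOnNhd ℂ g unitDisk) {r : ℝ} (hr0 : 0 ≤ r) (hr : r < 1) :
    Summable fun n => ‖taylorCoeff f n * taylorCoeff g n‖ * r ^ n := by
  -- Each coefficient sequence absorbs one factor (√r)ⁿ of rⁿ, and one of the two resulting
  -- sequences is bounded by its sum.
  have hs : Real.sqrt r < 1 := by rw [Real.sqrt_lt' one_pos]; simpa using hr
  have h1 := summable_norm_taylorCoeff hf (Real.sqrt_nonneg r) hs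
  have h2 := summable_norm_taylorCoeff hg (Real.sqrt_nonneg r) hs
  refine Summable.of_nonneg_of_le (fun n => by positivity) (fun n => ?_)
    (h1.mul_right (∑' n, ‖taylorCoeff g n‖ * Real.sqrt r ^ n))
  have h3 := h2.le_tsum n fun m _ => by positivity
  calc ‖taylorCoeff f n * taylorCoeff g n‖ * r ^ n
      = (‖taylorCoeff f n‖ * Real.sqrt r ^ n) * (‖taylorCoeff g n‖ * Real.sqrt r ^ n) := by
        conv_lhs => rw [norm_mul, ← Real.mul_self_sqrt hr0, mul_pow]
        ring
    _ ≤ _ := by gcongr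

theorem summable_conv {f g : ℂ → ℂ} (hf : AnalyticOnNhd ℂ f unitDisk)
    (hg : AnalyticOnNhd ℂ g unitDisk) {z : ℂ} (hz : z ∈ unitDisk) :
    Summable fun n => taylorCoeff f n * taylorCoeff g n * z ^ n := by
  refine Summable.of_norm ?_
  refine (summable_norm_taylorCoeff_mul hf hg (norm_nonneg z) (mem_unitDisk.1 hz)).congr
    fun n => ?_
  rw [norm_mul _ (z ^ n), norm_pow]

theorem hasFPowerSeriesOnBall_conv {f g : ℂ → ℂ} (hf : AnalyticOnNhd ℂ f unitDisk)
    (hg : AnalyticOnNhd ℂ g unitDisk) :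
    HasFPowerSeriesOnBall (conv f g)
      (FormalMultilinearSeries.ofScalars ℂ fun n => taylorCoeff f n * taylorCoeff g n) 0 1 := by
  set p := FormalMultilinearSeries.ofScalars ℂ fun n => taylorCoeff f n * taylorCoeff g n with hp
  have hrad : 1 ≤ p.radius := by
    refine ENNReal.le_of_forall_nnreal_lt fun r hr => p.le_radius_of_summable ?_
    have hr' : (r : ℝ) < 1 := by exact_mod_cast hr
    refine (summable_norm_taylorCoeff_mul hf hg r.2 hr').congr fun n => ?_
    rw [hp, FormalMultilinearSeries.ofScalars_norm]
    rfl
  have h1 := (p.hasFPowerSeriesOnBall (one_pos.trans_le hrad)).mono one_pos hrad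
  refine h1.congr fun z _ => ?_
  simp only [FormalMultilinearSeries.sum, conv, hp, FormalMultilinearSeries.ofScalars_apply_eq,
    smul_eq_mul]

theorem analyticOnNhd_conv {f g : ℂ → ℂ} (hf : AnalyticOnNhd ℂ f unitDisk)
    (hg : AnalyticOnNhd ℂ g unitDisk) : AnalyticOnNhd ℂ (conv f g) unitDisk := by
  have := (hasFPowerSeriesOnBall_conv hf hg).analyticOnNhd
  rwa [← ENNReal.coe_one, Metric.eball_coe, NNReal.coe_one] at this

theorem conv_zero (f g : ℂ → ℂ) : conv f g 0 = f 0 * g 0 := by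
  rw [conv, tsum_eq_single 0 fun n hn => by simp [hn]]
  simp [taylorCoeff_zero]

theorem deriv_conv_zero {f g : ℂ → ℂ} (hf : AnalyticOnNhd ℂ f unitDisk)
    (hg : AnalyticOnNhd ℂ g unitDisk) : deriv (conv f g) 0 = deriv f 0 * deriv g 0 := by
  rw [(hasFPowerSeriesOnBall_conv hf hg).hasFPowerSeriesAt.deriv,
    FormalMultilinearSeries.ofScalars_apply_eq]
  simp [taylorCoeff_one]

theorem conv_comm (f g : ℂ → ℂ) : conv f g = conv g f := by
  funext z
  simp only [conv, mul_comm (taylorCoeff f _)]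

theorem conv_const_mul (c : ℂ) (f g : ℂ → ℂ) (z : ℂ) :
    conv (fun z => c * f z) g z = c * conv f g z := by
  simp only [conv, taylorCoeff_const_mul, mul_assoc]
  rw [tsum_mul_left]

theorem conv_add {f₁ f₂ g : ℂ → ℂ} (hf₁ : AnalyticOnNhd ℂ f₁ unitDisk)
    (hf₂ : AnalyticOnNhd ℂ f₂ unitDisk) (hg : AnalyticOnNhd ℂ g unitDisk) {z : ℂ}
    (hz : z ∈ unitDisk) :
    conv (fun z => f₁ z + f₂ z) g z = conv f₁ g z + conv f₂ g z := by
  have h0 : (0 : ℂ) ∈ unitDisk := by simp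
  simp only [conv, taylorCoeff_add (hf₁ 0 h0) (hf₂ 0 h0), add_mul]
  exact (summable_conv hf₁ hg hz).tsum_add (summable_conv hf₂ hg hz)

/-- Convolution with a `DCP` function preserves convexity in a direction, without
normalization. -/
theorem conv_of_mem_classDCP {φ F : ℂ → ℂ} {d : ℂ} (hφ : φ ∈ classDCP) (hd : d ≠ 0)
    (hF : AnalyticOnNhd ℂ F unitDisk) (hinj : InjOn F unitDisk) (hF0 : F 0 = 0)
    (hconv : ConvexAlong d (F '' unitDisk)) :
    InjOn (conv F φ) unitDisk ∧ ConvexAlong d (conv F φ '' unitDisk) ∧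
      deriv (conv F φ) 0 = deriv F 0 := by
  have h0 : (0 : ℂ) ∈ unitDisk := by simp
  set a := deriv F 0 with ha
  have ha0 : a ≠ 0 := (hF 0 h0).deriv_ne_zero_of_injOn unitDisk_mem_nhds_zero hinj
  have hai : a⁻¹ ≠ 0 := inv_ne_zero ha0
  -- Normalizing F by a⁻¹ rotates the direction d to a⁻¹d; this is harmless because φ preserves
  -- every direction.
  obtain ⟨γ, r, hγ0, hγπ, hr, hγ⟩ := exists_angle_eq_real_mul (mul_ne_zero hai hd)
  set f : ℂ → ℂ := fun z => a⁻¹ * F z with hf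
  have himg : f '' unitDisk = (fun z => a⁻¹ * z) '' (F '' unitDisk) := by
    rw [image_image]
  have hfK : f ∈ classK γ := by
    refine ⟨⟨fun z hz => analyticAt_const.mul (hF z hz), ?_, ?_, ?_⟩, ?_⟩
    · intro z hz y hy hzy
      exact hinj hz hy (mul_left_cancel₀ hai hzy)
    · simp [hf, hF0]
    · rw [hf, deriv_const_mul_field, ← ha, inv_mul_cancel₀ ha0]
    · rw [convexInDirection_iff, himg]
      have h1 := (hconv.image_mul hai).real_mul (inv_ne_zero hr)
      rw [hγ, ← mul_assoc, ← Complex.ofReal_mul, inv_mul_cancel₀ hr, Complex.ofReal_one,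
        one_mul] at h1
      exact h1
  obtain ⟨⟨-, hcinj, -, hc1⟩, hcc⟩ := hφ.2 γ hγ0 hγπ f hfK
  have hFc : conv F φ = fun z => a * conv φ f z := by
    funext z
    rw [conv_comm φ f, hf, conv_const_mul, mul_inv_cancel_left₀ ha0]
  rw [convexInDirection_iff] at hcc
  refine ⟨?_, ?_, ?_⟩
  · intro z hz y hy hzy
    rw [hFc] at hzy
    exact hcinj hz hy (mul_left_cancel₀ ha0 hzy)
  · have h1 := (hcc.real_mul hr).image_mul ha0
    rw [← hγ, mul_inv_cancel_left₀ ha0, image_image] at h1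
    rwa [hFc]
  · rw [hFc, deriv_const_mul_field, hc1, mul_one]

/-! ### The half-plane map z/(1 - βz). -/

section HalfPlaneMap

variable {β : ℂ}

theorem injOn_halfPlaneMap (hβ : ‖β‖ = 1) : InjOn (fun z => z / (1 - β * z)) unitDisk := by
  intro z hz y hy hzy
  have h1 := one_sub_mul_ne_zero hβ hz
  have h2 := one_sub_mul_ne_zero hβ hy
  simp only at hzy
  rw [div_eq_div_iff h1 h2] at hzy
  linear_combination hzy

theorem image_halfPlaneMap (hβ : ‖β‖ = 1) :
    (fun z => z / (1 - β * z)) '' unitDisk = {ζ | -(1 / 2) < (β * ζ).re} := by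
  have hβ0 : β ≠ 0 := by rintro rfl; simp at hβ
  ext ζ
  constructor
  · rintro ⟨z, hz, rfl⟩
    have h1 : ‖β * z‖ < 1 := by rw [norm_mul, hβ, one_mul]; exact mem_unitDisk.1 hz
    have h2 := re_dilatation_pos h1
    change -(1 / 2) < (β * (z / (1 - β * z))).re
    rw [mul_div_assoc']
    linarith
  · intro hζ
    have hζ' : -(1 / 2) < (β * ζ).re := hζ
    -- The condition Re(βζ) > -1/2 says that βζ is nearer to 0 than to -1, which is what puts the
    -- preimage ζ/(1 + βζ) in the disk.
    have hlt : ‖β * ζ‖ < ‖1 + β * ζ‖ := by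
      rw [← sq_lt_sq₀ (norm_nonneg _) (norm_nonneg _), ← Complex.normSq_eq_norm_sq,
        ← Complex.normSq_eq_norm_sq, Complex.normSq_apply, Complex.normSq_apply, Complex.add_re,
        Complex.add_im, Complex.one_re, Complex.one_im]
      nlinarith
    have hne : 1 + β * ζ ≠ 0 := norm_pos_iff.1 ((norm_nonneg _).trans_lt hlt)
    refine ⟨ζ / (1 + β * ζ), ?_, ?_⟩
    · rw [mem_unitDisk, norm_div, div_lt_one ((norm_nonneg _).trans_lt hlt)]
      rwa [norm_mul, hβ, one_mul] at hlt
    · have h1 : 1 - β * (ζ / (1 + β * ζ)) = 1 / (1 + β * ζ) := by field_simp; ring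
      simp only
      rw [h1, div_div_div_cancel_right₀ hne, div_one]

theorem convex_image_halfPlaneMap (hβ : ‖β‖ = 1) :
    Convex ℝ ((fun z => z / (1 - β * z)) '' unitDisk) := by
  rw [image_halfPlaneMap hβ]
  refine convex_halfSpace_gt (f := fun ζ : ℂ => (β * ζ).re) ⟨fun x y => ?_, fun c x => ?_⟩ _
  · rw [mul_add, Complex.add_re]
  · rw [Complex.real_smul, mul_left_comm, Complex.re_ofReal_mul, smul_eq_mul]

theorem hasDerivAt_halfPlaneMap (hβ : ‖β‖ = 1) {z : ℂ} (hz : z ∈ unitDisk) :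
    HasDerivAt (fun z => z / (1 - β * z)) (1 / (1 - β * z) ^ 2) z := by
  have h1 := one_sub_mul_ne_zero hβ hz
  have h2 : HasDerivAt (fun z => 1 - β * z) (-β) z := by
    simpa using ((hasDerivAt_id z).const_mul β).const_sub 1
  convert! (hasDerivAt_id z).div h2 h1 using 1
  simp only [id]
  congr 1
  ring

end HalfPlaneMap

/-! ### The family h + εg and the dilatation bound. -/

/-- For unimodular `η ≠ 1`, the Möbius map `ω ↦ (1 + η ω) / (1 + ω)` sends the unit disk into a
half-plane bounded by a line through the origin. -/
theorem re_moebius_pos {η ω : ℂ} (hη : ‖η‖ = 1) (hη1 : η ≠ 1) (hω : ‖ω‖ < 1) :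
    0 < ((1 - conj η) * ((1 + η * ω) / (1 + ω))).re := by
  have h1 : 1 + ω ≠ 0 := by
    intro h0
    rw [eq_neg_of_add_eq_zero_right h0] at hω
    simp at hω
  have hη2 : η.re * η.re + η.im * η.im = 1 := by
    rw [← Complex.normSq_apply, Complex.normSq_eq_norm_sq, hη, one_pow]
  have hω2 : ω.re * ω.re + ω.im * ω.im < 1 := by
    rw [← Complex.normSq_apply, Complex.normSq_eq_norm_sq]
    nlinarith [norm_nonneg ω]
  have hre : η.re < 1 := by
    by_contra hge
    have h2 : η.re = 1 := by nlinarith [mul_self_nonneg η.im]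
    have h3 : η.im = 0 := by
      rw [h2] at hη2
      exact mul_self_eq_zero.1 (by linarith)
    exact hη1 (Complex.ext h2 h3)
  have h4 : (1 - conj η) * ((1 + η * ω) / (1 + ω)) =
      (((Complex.normSq (1 + ω))⁻¹ : ℝ) : ℂ) * ((1 - conj η) * (1 + η * ω) * conj (1 + ω)) := by
    rw [Complex.ofReal_inv, ← Complex.mul_conj]
    have h5 : conj (1 + ω) ≠ 0 := (map_ne_zero _).2 h1
    field_simp
  rw [h4, Complex.re_ofReal_mul]
  refine mul_pos (inv_pos.2 (Complex.normSq_pos.2 h1)) ?_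
  -- The right side vanishes for |ω| = 1: the factor 1 - conj η rotates the bounding line onto the
  -- imaginary axis.
  have h6 : ((1 - conj η) * (1 + η * ω) * conj (1 + ω)).re =
      (1 - (ω.re * ω.re + ω.im * ω.im)) * (1 - η.re) := by
    simp only [Complex.mul_re, Complex.mul_im, Complex.sub_re, Complex.sub_im, Complex.add_re,
      Complex.add_im, Complex.one_re, Complex.one_im, Complex.conj_re, Complex.conj_im, map_add,
      map_one]
    linear_combination (-(ω.re * ω.re + ω.im * ω.im) - ω.re) * hη2
  rw [h6]
  exact mul_pos (by linarith) (by linarith)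

/-- If `h + β⁻² g` is the half-plane map `z / (1 - β z)` and `h + conj g` is sense-preserving,
then every `h + ε g` with `|ε| = 1` is univalent with image convex along some line. -/
theorem injOn_and_convexAlong_of_halfPlane {h g : ℂ → ℂ} {β ε : ℂ} (hβ : ‖β‖ = 1) (hε : ‖ε‖ = 1)
    (hh : AnalyticOnNhd ℂ h unitDisk) (hg : AnalyticOnNhd ℂ g unitDisk)
    (hω : DilatationLtOne h g)
    (hhg : EqOn (fun z => h z + (β ^ 2)⁻¹ * g z) (fun z => z / (1 - β * z)) unitDisk) :
    InjOn (fun z => h z + ε * g z) unitDisk ∧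
      ∃ d ≠ 0, ConvexAlong d ((fun z => h z + ε * g z) '' unitDisk) := by
  have hβ0 : β ≠ 0 := by rintro rfl; simp at hβ
  -- This is the case η = 1 excluded from the Möbius lemma; the function is then the half-plane map,
  -- convex along every line.
  by_cases hεβ : ε = (β ^ 2)⁻¹
  · rw [hεβ]
    exact ⟨hhg.injOn_iff.2 (injOn_halfPlaneMap hβ), 1, one_ne_zero, by
      rw [hhg.image_eq]; exact (convex_image_halfPlaneMap hβ).convexAlong 1⟩
  refine injOn_and_convexAlong_of_re_pos (β := β) (c := 1 - conj (ε * β ^ 2)) hβ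
    (fun z hz => (hh z hz).add (analyticAt_const.mul (hg z hz))) fun z hz => ?_
  have hd : ∀ c, HasDerivAt (fun z => h z + c * g z) (deriv h z + c * deriv g z) z := fun c =>
    (hh z hz).differentiableAt.hasDerivAt.add
      ((hg z hz).differentiableAt.hasDerivAt.const_mul c)
  have h1 : deriv h z + (β ^ 2)⁻¹ * deriv g z = 1 / (1 - β * z) ^ 2 := by
    refine (hd _).unique ((hasDerivAt_halfPlaneMap hβ hz).congr_of_eventuallyEq ?_)
    filter_upwards [Metric.isOpen_ball.mem_nhds hz] with x hx using hhg hx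
  obtain ⟨hh0, hlt⟩ := hω z hz
  have hw : ‖(β ^ 2)⁻¹ * (deriv g z / deriv h z)‖ < 1 := by
    rw [norm_mul, norm_inv, norm_pow, hβ]; simpa using! hlt
  have key := re_moebius_pos (η := ε * β ^ 2) (by rw [norm_mul, norm_pow, hβ, hε]; norm_num)
    (fun h0 => hεβ (eq_inv_of_mul_eq_one_left h0)) hw
  convert key using 3
  rw [(hd ε).deriv]
  have h2 := one_sub_mul_ne_zero hβ hz
  have h3 : 1 + (β ^ 2)⁻¹ * (deriv g z / deriv h z) = 1 / ((1 - β * z) ^ 2 * deriv h z) := by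
    rw [← div_div, ← h1]
    field_simp
  rw [h3]
  field_simp

/-- At a point where |u| = |v| ≠ 0, the unimodular number ε = -u/v would make u + εv vanish. The
norms therefore never agree, and their order cannot change on a connected set. -/
theorem norm_lt_of_forall_add_mul_ne_zero {u v : ℂ → ℂ} {S : Set ℂ} (hS : IsPreconnected S)
    (hu : ContinuousOn u S) (hv : ContinuousOn v S) {z₀ : ℂ} (hz₀ : z₀ ∈ S)
    (h₀ : ‖v z₀‖ < ‖u z₀‖) (hne : ∀ ε : ℂ, ‖ε‖ = 1 → ∀ z ∈ S, u z + ε * v z ≠ 0) :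
    ∀ z ∈ S, ‖v z‖ < ‖u z‖ := by
  have hnorm : ∀ z ∈ S, ‖v z‖ ≠ ‖u z‖ := by
    intro z hz heq
    by_cases hv0 : v z = 0
    · have hu0 : u z = 0 := by rwa [hv0, norm_zero, eq_comm, norm_eq_zero] at heq
      exact hne 1 norm_one z hz (by rw [hu0, hv0]; ring)
    · refine hne (-(u z / v z)) ?_ z hz (by field_simp; ring)
      rw [norm_neg, norm_div, heq, div_self]
      rw [← heq]; exact norm_ne_zero_iff.2 hv0
  intro z hz
  by_contra! hle
  obtain ⟨y, hy, hy0⟩ := hS.intermediate_value₂ hz₀ hz hv.norm hu.norm h₀.le hle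
  exact hnorm y hy hy0

end HarmonicConvolution

/-! ### Assembly of the corollary. -/

theorem corollary3p5 (α : ℝ) (hα₁ : -(Real.pi / 2) ≤ α) (hα₂ : α ≤ Real.pi / 2)
    (h g : ℂ → ℂ) (hf : HarmonicConvolution.IsNormalizedHarmonic h g)
    (hω : HarmonicConvolution.DilatationLtOne h g)
    (hhg : ∀ z ∈ HarmonicConvolution.unitDisk,
      h z + Complex.exp (-2 * Complex.I * (α : ℂ)) * g z =
        z / (1 - Complex.exp (Complex.I * (α : ℂ)) * z))
    (φ : ℂ → ℂ) (hφ : φ ∈ HarmonicConvolution.classDCP) :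
    HarmonicConvolution.harmonicConv h g φ ∈
      HarmonicConvolution.classKH (Real.pi / 2 - α) := by
  open HarmonicConvolution in
  have h0 : (0 : ℂ) ∈ unitDisk := by simp
  have hh := hf.analytic_h
  have hg := hf.analytic_g
  set β := Complex.exp (Complex.I * (α : ℂ)) with hβdef
  have hβ : ‖β‖ = 1 := by rw [hβdef, mul_comm]; exact Complex.norm_exp_ofReal_mul_I α
  have hβ2 : Complex.exp (-2 * Complex.I * (α : ℂ)) = (β ^ 2)⁻¹ := by
    rw [hβdef, ← Complex.exp_nat_mul, ← Complex.exp_neg]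
    congr 1
    push_cast; ring
  set d := Complex.exp (Complex.I * ((Real.pi / 2 - α : ℝ) : ℂ)) with hd
  have hd1 : ‖d‖ = 1 := by rw [hd, mul_comm]; exact Complex.norm_exp_ofReal_mul_I _
  have hd0 : d ≠ 0 := Complex.exp_ne_zero _
  -- This identifies the combination required by the shear along d with the given half-plane map;
  -- after writing -1 = e^{iπ} the exponents differ by 2πi.
  have hd2 : -d ^ 2 = (β ^ 2)⁻¹ := by
    rw [← hβ2, hd, ← Complex.exp_nat_mul, ← neg_one_mul, ← Complex.exp_pi_mul_I,
      ← Complex.exp_add, Complex.exp_eq_exp_iff_exists_int]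
    exact ⟨1, by push_cast; ring⟩
  rw [hβ2] at hhg
  have hcomb : ∀ ε : ℂ, AnalyticOnNhd ℂ (fun z => h z + ε * g z) unitDisk := fun ε z hz =>
    (hh z hz).add (analyticAt_const.mul (hg z hz))
  have hconvcomb : ∀ ε : ℂ, Set.EqOn (conv (fun z => h z + ε * g z) φ)
      (fun z => conv h φ z + ε * conv g φ z) unitDisk := fun ε z hz => by
    simp only
    rw [conv_add (f₂ := fun z => ε * g z) hh (fun z hz => analyticAt_const.mul (hg z hz)) hφ.1 hz,
      conv_const_mul]
  have hcomb0 : ∀ ε : ℂ, h 0 + ε * g 0 = 0 := fun ε => by rw [hf.h_zero, hf.g_zero]; ring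
  have hH := analyticOnNhd_conv hh hφ.1
  have hG := analyticOnNhd_conv hg hφ.1
  have hmain : Set.InjOn (conv (fun z => h z + (β ^ 2)⁻¹ * g z) φ) unitDisk ∧
      ConvexAlong d (conv (fun z => h z + (β ^ 2)⁻¹ * g z) φ '' unitDisk) ∧
      deriv (conv (fun z => h z + (β ^ 2)⁻¹ * g z) φ) 0 =
        deriv (fun z => h z + (β ^ 2)⁻¹ * g z) 0 := by
    refine conv_of_mem_classDCP hφ hd0 (hcomb _) (Set.EqOn.injOn_iff hhg |>.2
      (injOn_halfPlaneMap hβ)) (hcomb0 _) ?_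
    rw [Set.EqOn.image_eq hhg]
    exact (convex_image_halfPlaneMap hβ).convexAlong d
  -- Convolution with φ multiplies the derivative at 0 by φ'(0), yet DCP functions preserve it.
  have hφ1 : deriv φ 0 = 1 := by
    have h1 := hmain.2.2
    rw [deriv_conv_zero (hcomb _) hφ.1] at h1
    have h2 : deriv (fun z => h z + (β ^ 2)⁻¹ * g z) 0 ≠ 0 :=
      (hcomb _ 0 h0).deriv_ne_zero_of_injOn unitDisk_mem_nhds_zero
        (Set.EqOn.injOn_iff hhg |>.2 (injOn_halfPlaneMap hβ))
    exact mul_left_cancel₀ h2 (h1.trans (mul_one _).symm)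
  have hH0 : deriv (conv h φ) 0 = 1 := by
    rw [deriv_conv_zero hh hφ.1, hf.deriv_h_zero, hφ1, one_mul]
  have hG0 : deriv (conv g φ) 0 = deriv g 0 := by
    rw [deriv_conv_zero hg hφ.1, hφ1, mul_one]
  -- The direction `e` depends on ε and is discarded: only the univalence of the convolved function
  -- matters here.
  have hne : ∀ ε : ℂ, ‖ε‖ = 1 → ∀ z ∈ unitDisk,
      deriv (conv h φ) z + ε * deriv (conv g φ) z ≠ 0 := by
    intro ε hε z hz
    obtain ⟨hinj, e, he, hconv⟩ := injOn_and_convexAlong_of_halfPlane hβ hε hh hg hω hhg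
    have h1 := (conv_of_mem_classDCP hφ he (hcomb ε) hinj (hcomb0 ε) hconv).1
    have h2 : Set.InjOn (fun z => conv h φ z + ε * conv g φ z) unitDisk :=
      (hconvcomb ε).injOn_iff.1 h1
    have h3 := ((hH z hz).add (analyticAt_const.mul (hG z hz))).deriv_ne_zero_of_injOn
      (Metric.isOpen_ball.mem_nhds hz) h2
    have h4 := (hH z hz).differentiableAt.hasDerivAt.add
      ((hG z hz).differentiableAt.hasDerivAt.const_mul ε)
    exact h4.deriv ▸ h3
  have hlt : ∀ z ∈ unitDisk, ‖deriv (conv g φ) z‖ < ‖deriv (conv h φ) z‖ := by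
    refine norm_lt_of_forall_add_mul_ne_zero (convex_ball _ _).isPreconnected
      hH.deriv.continuousOn hG.deriv.continuousOn h0 ?_ hne
    rw [hH0, hG0, norm_one]
    simpa [hf.deriv_h_zero] using (hω 0 h0).2
  have hdil : DilatationLtOne (conv h φ) (conv g φ) := by
    intro z hz
    have h1 : 0 < ‖deriv (conv h φ) z‖ := (norm_nonneg _).trans_lt (hlt z hz)
    refine ⟨norm_pos_iff.1 h1, ?_⟩
    rw [norm_div, div_lt_one h1]
    exact hlt z hz
  have heq : Set.EqOn (conv (fun z => h z + (β ^ 2)⁻¹ * g z) φ)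
      (fun z => conv h φ z - d ^ 2 * conv g φ z) unitDisk := fun z hz => by
    rw [hconvcomb _ hz, ← hd2]
    ring
  obtain ⟨hinj, hconv⟩ := shear hd1 hH hG hdil (heq.injOn_iff.1 hmain.1)
    (heq.image_eq ▸ hmain.2.1)
  refine ⟨⟨conv h φ, conv g φ, ⟨hH, hG, ?_, ?_, hH0⟩, hdil, fun z _ => rfl, hinj⟩, hconv⟩
  · rw [conv_zero, hf.h_zero, zero_mul]
  · rw [conv_zero, hf.g_zero, zero_mul]
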